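/- Let $\Gamma$ be a simple closed convex curve of class $C^1$ (with nowhere vanishing derivative) in the Euclidean plane, and consider the Birkhoff billiard inside $\Gamma$. For a curve $\gamma$, let $\operatorname{int}\gamma$ be the open set that it bounds and $\bar\gamma=\operatorname{int}\gamma\cup\gamma$. A convex caustic of $\Gamma$ is a set $\gamma\subset\operatorname{int}\Gamma$ such that $\bar\gamma$ is a nonempty compact convex set with boundary $\gamma$ (so $\gamma$ is a convex simple closed curve or, in the degenerate case $\operatorname{int}\gamma=\emptyset$, a segment or a point) and every supporting line of $\bar\gamma$ is again a supporting line of $\bar\gamma$ after billiard reflection in $\Gamma$. Let $\gamma$ be a convex caustic of $\Gamma$, and let $r_\gamma$ be the set of all supporting lines of $\bar\gamma$, oriented so that $\bar\gamma$ lies to their left; it is a closed curve in the phase cylinder of oriented lines, parametrized by the direction angle $\varphi\in\mathbb R/2\pi\mathbb Z$. Then $r_\gamma$ is invariant under the billiard ball map, which acts on it as a degree-one monotone circle map, so that it has a well-defined rotation number $$\rho_\gamma=\lim_{n\to\infty}\frac{\varphi_n-\varphi_0}{2\pi n},$$ where $\varphi_0,\varphi_1,\dots$ are the lifted direction angles along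 any orbit in $r_\gamma$, chosen with $0<\varphi_{n+1}-\varphi_n<2\pi$. Moreover: 1. $\operatorname{int}\gamma\neq\emptyset$ if and only if $\rho_\gamma<\tfrac12$. 2. If $\operatorname{int}\gamma=\emptyset$, then either $\gamma$ is a point and $\Gamma$ is a circle centred at it, or $\gamma$ is a nondegenerate segment and $\Gamma$ is an ellipse whose foci are the endpoints of $\gamma$. -/

import Mathlib

open Set Real

/-! The Euclidean plane is `ℂ` with its real inner product. -/

namespace Billiard

noncomputable section

/-- The open set bounded by `γ`: the union of the bounded components of its complement
(for a simple closed curve, its Jordan interior; empty for a point or a segment). -/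
def enclosed (γ : Set ℂ) : Set ℂ :=
  {z | z ∉ γ ∧ Bornology.IsBounded (connectedComponentIn γᶜ z)}

/-- The closed region bounded by `γ`, i.e. the enclosed set together with `γ`. -/
def closedRegion (γ : Set ℂ) : Set ℂ := enclosed γ ∪ γ

/-- `γ` is a (possibly degenerate) closed convex curve: the closed region that it bounds is convex
and has `γ` as its boundary. Such a `γ` is a convex simple closed curve, a segment, or a point. -/
structure IsConvexCurve (γ : Set ℂ) : Prop where
  nonempty : γ.Nonempty
  isCompact : IsCompact γ
  convex : Convex ℝ (closedRegion γ)
  frontier_eq : frontier (closedRegion γ) = γ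

/-- `Γ` is a regular parametrization, of period `1`, of a simple closed convex
curve of class `C¹`. -/
structure IsTable (Γ : ℝ → ℂ) : Prop where
  contDiff : ContDiff ℝ 1 Γ
  periodic : Function.Periodic Γ 1
  deriv_ne_zero : ∀ t, deriv Γ t ≠ 0
  injOn : InjOn Γ (Ico 0 1)
  convex : IsConvexCurve (range Γ)

/-- The unit vector `e^{iφ}`. -/
def unitVec (φ : ℝ) : ℂ := Complex.exp (φ * Complex.I)

/-- The line with coordinates `ℓ = (p, φ)`: the points `z` with `⟨e^{iφ}, z⟩ = p`. With the
direction `lineDir ℓ` it is an oriented line, and `(p, φ)` are its coordinates in the universal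
cover `ℝ × ℝ` of the phase cylinder `ℝ × 𝕊¹` of oriented lines. -/
def line (ℓ : ℝ × ℝ) : Set ℂ := {z | inner ℝ (unitVec ℓ.2) z = ℓ.1}

/-- The direction of the oriented line `ℓ = (p, φ)`: the vector `i e^{iφ}`. -/
def lineDir (ℓ : ℝ × ℝ) : ℂ := Complex.I * unitVec ℓ.2

/-- The closed half-plane to the left of the oriented line `ℓ`. -/
def leftSide (ℓ : ℝ × ℝ) : Set ℂ := {z | inner ℝ (unitVec ℓ.2) z ≤ ℓ.1}

/-- The closed half-plane to the right of the oriented line `ℓ`. -/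
def rightSide (ℓ : ℝ × ℝ) : Set ℂ := {z | ℓ.1 ≤ inner ℝ (unitVec ℓ.2) z}

/-- The line `ℓ` is a supporting line of `K` (on either side). -/
def IsSupportingLine (K : Set ℂ) (ℓ : ℝ × ℝ) : Prop :=
  (K ∩ line ℓ).Nonempty ∧ (K ⊆ leftSide ℓ ∨ K ⊆ rightSide ℓ)

/-- The billiard ball map inside `Γ` on oriented lines: the oriented line `ℓ` crosses the interior
and leaves the table at the point `Γ t`; `ℓ'` is the oriented line through `Γ t` whose direction is
that of `ℓ` reflected in the tangent line. -/
def BilliardMap (Γ : ℝ → ℂ) (ℓ ℓ' : ℝ × ℝ) : Prop :=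
  ∃ t : ℝ, Γ t ∈ line ℓ ∧
    (∃ s : ℝ, 0 < s ∧ Γ t - s • lineDir ℓ ∈ enclosed (range Γ)) ∧
    Γ t ∈ line ℓ' ∧
    lineDir ℓ' = (Submodule.span ℝ {deriv Γ t}).reflection (lineDir ℓ)

/-- The lift of the billiard ball map to the universal cover of the phase cylinder for which every
reflection turns the direction by an angle in `(0, 2π)`. -/
def BilliardLift (Γ : ℝ → ℂ) (ℓ ℓ' : ℝ × ℝ) : Prop :=
  BilliardMap Γ ℓ ℓ' ∧ ℓ.2 < ℓ'.2 ∧ ℓ'.2 < ℓ.2 + 2 * π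

/-- `γ` is a convex caustic of the table `Γ`: it is a closed convex curve (possibly a segment or a
point) in the interior of `Γ`, and every supporting line of its closed region is again a
supporting line of it after billiard reflection. -/
structure IsConvexCaustic (Γ : ℝ → ℂ) (γ : Set ℂ) : Prop where
  isConvexCurve : IsConvexCurve γ
  subset : γ ⊆ enclosed (range Γ)
  reflect : ∀ ℓ ℓ' : ℝ × ℝ, IsSupportingLine (closedRegion γ) ℓ → BilliardMap Γ ℓ ℓ' →
    IsSupportingLine (closedRegion γ) ℓ'

/-- The curve `r_γ` of all supporting lines of `γ`, oriented so that `γ` lies to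
their left (in the universal cover). -/
def invariantCurve (γ : Set ℂ) : Set (ℝ × ℝ) :=
  {ℓ | (closedRegion γ ∩ line ℓ).Nonempty ∧ closedRegion γ ⊆ leftSide ℓ}

/-- `ρ` is the rotation number of the billiard ball map on the invariant curve `r_γ`: the lifted
billiard map sends `r_γ` to itself, and in the angular coordinate `φ / 2π` on `r_γ` it is the lift
`f` of a circle map of degree one, with translation number `ρ`. -/
def HasRotationNumber (Γ : ℝ → ℂ) (γ : Set ℂ) (ρ : ℝ) : Prop :=
  ∃ f : CircleDeg1Lift, f.translationNumber = ρ ∧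
    ∀ ℓ ∈ invariantCurve γ, ∃ ℓ' ∈ invariantCurve γ,
      BilliardLift Γ ℓ ℓ' ∧ ℓ'.2 / (2 * π) = f (ℓ.2 / (2 * π))

end

end Billiard

namespace Billiard

/-! ### Unit vectors and reflections -/

lemma unitVec_re (φ : ℝ) : (unitVec φ).re = cos φ := Complex.exp_ofReal_mul_I_re φ

lemma unitVec_im (φ : ℝ) : (unitVec φ).im = sin φ := Complex.exp_ofReal_mul_I_im φ

lemma lineDir_re (ℓ : ℝ × ℝ) : (lineDir ℓ).re = -sin ℓ.2 := by
  simp [lineDir, unitVec_im]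

lemma lineDir_im (ℓ : ℝ × ℝ) : (lineDir ℓ).im = cos ℓ.2 := by
  simp [lineDir, unitVec_re]

lemma inner_eq (w z : ℂ) : inner ℝ w z = w.re * z.re + w.im * z.im := by
  simp [Complex.inner]; ring

lemma inner_unitVec (φ : ℝ) (w : ℂ) :
    inner ℝ (unitVec φ) w = cos φ * w.re + sin φ * w.im := by
  rw [inner_eq, unitVec_re, unitVec_im]

lemma inner_unitVec_lineDir (ψ p φ : ℝ) :
    inner ℝ (unitVec ψ) (lineDir (p, φ)) = sin (ψ - φ) := by
  rw [inner_unitVec, lineDir_re, lineDir_im, sin_sub]; ring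

lemma norm_unitVec (φ : ℝ) : ‖unitVec φ‖ = 1 := Complex.norm_exp_ofReal_mul_I φ

lemma unitVec_ne_zero (φ : ℝ) : unitVec φ ≠ 0 := Complex.exp_ne_zero _

lemma lineDir_ne_zero (ℓ : ℝ × ℝ) : lineDir ℓ ≠ 0 :=
  mul_ne_zero Complex.I_ne_zero (unitVec_ne_zero _)

lemma exists_unitVec (w : ℂ) : ∃ ψ : ℝ, w = ‖w‖ • unitVec ψ :=
  ⟨w.arg, by rw [unitVec, Complex.real_smul, Complex.norm_mul_exp_arg_mul_I]⟩

lemma exists_lineDir (w : ℂ) : ∃ φ : ℝ, ∀ p : ℝ, w = ‖w‖ • lineDir (p, φ) := by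
  obtain ⟨ψ, hψ⟩ := exists_unitVec w
  refine ⟨ψ - π / 2, fun p => ?_⟩
  nth_rewrite 1 [hψ]
  congr 1
  apply Complex.ext
  · rw [unitVec_re, lineDir_re, sin_sub_pi_div_two, neg_neg]
  · rw [unitVec_im, lineDir_im, cos_sub_pi_div_two]

lemma unitVec_eq_iff {φ ψ : ℝ} : unitVec φ = unitVec ψ ↔ ∃ n : ℤ, φ = ψ + n * (2 * π) := by
  rw [unitVec, unitVec, Complex.exp_eq_exp_iff_exists_int]
  refine exists_congr fun n => ?_
  constructor
  · intro h
    have := congrArg Complex.im h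
    simpa using this
  · rintro rfl
    push_cast
    ring

/-- Reflection in the line orthogonal to the unit vector at angle `ψ`, for a line direction. -/
lemma reflection_lineDir {v : ℂ} (hv : v ≠ 0) {ψ : ℝ} (h : inner ℝ (unitVec ψ) v = 0)
    (p q φ : ℝ) :
    (Submodule.span ℝ {v}).reflection (lineDir (p, φ)) = lineDir (q, 2 * ψ - φ) := by
  have hn : unitVec ψ ∈ (Submodule.span ℝ {v})ᗮ := by
    rw [Submodule.mem_orthogonal_singleton_iff_inner_right, real_inner_comm, h]
  have ht : lineDir (p, ψ) ∈ Submodule.span ℝ {v} := by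
    rw [Submodule.mem_span_singleton]
    have hv2 : v.re ^ 2 + v.im ^ 2 ≠ 0 := by
      intro h0
      apply hv
      apply Complex.ext
      · simp; nlinarith [sq_nonneg v.re, sq_nonneg v.im]
      · simp; nlinarith [sq_nonneg v.re, sq_nonneg v.im]
    rw [inner_unitVec] at h
    refine ⟨(cos ψ * v.im - sin ψ * v.re) / (v.re ^ 2 + v.im ^ 2), ?_⟩
    apply Complex.ext
    · rw [lineDir_re, Complex.smul_re, smul_eq_mul]
      field_simp
      linear_combination v.im * h
    · rw [lineDir_im, Complex.smul_im, smul_eq_mul]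
      field_simp
      linear_combination (-v.re) * h
  have hd : lineDir (p, φ) = cos (ψ - φ) • lineDir (p, ψ) + sin (ψ - φ) • unitVec ψ := by
    have e : φ = ψ - (ψ - φ) := by ring
    apply Complex.ext
    · simp only [Complex.add_re, Complex.smul_re, lineDir_re, unitVec_re, smul_eq_mul]
      nth_rewrite 1 [e]
      rw [sin_sub ψ]; ring
    · simp only [Complex.add_im, Complex.smul_im, lineDir_im, unitVec_im, smul_eq_mul]
      nth_rewrite 1 [e]
      rw [cos_sub ψ]; ring
  rw [hd, map_add, map_smul, map_smul, Submodule.reflection_mem_subspace_eq_self ht,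
    Submodule.reflection_mem_subspace_orthogonalComplement_eq_neg hn]
  have e : 2 * ψ - φ = ψ + (ψ - φ) := by ring
  apply Complex.ext
  · simp only [Complex.add_re, Complex.smul_re, Complex.neg_re, lineDir_re, unitVec_re,
      smul_eq_mul, e, sin_add ψ]
    ring
  · simp only [Complex.add_im, Complex.smul_im, Complex.neg_im, lineDir_im, unitVec_im,
      smul_eq_mul, e, cos_add ψ]
    ring

lemma inner_unitVec_add_reflect (φ ψ : ℝ) (w : ℂ) :
    inner ℝ (unitVec φ) w + inner ℝ (unitVec (2 * ψ - φ)) w =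
      2 * cos (ψ - φ) * inner ℝ (unitVec ψ) w := by
  have e : φ = ψ - (ψ - φ) := by ring
  have e' : 2 * ψ - φ = ψ + (ψ - φ) := by ring
  rw [e', inner_unitVec, inner_unitVec, inner_unitVec]
  nth_rewrite 1 2 [e]
  rw [sin_sub ψ, cos_sub ψ, cos_add ψ, sin_add ψ]
  ring

lemma sin_mul_inner_unitVec (α β χ : ℝ) (w : ℂ) :
    sin (β - α) * inner ℝ (unitVec χ) w =
      sin (β - χ) * inner ℝ (unitVec α) w + sin (χ - α) * inner ℝ (unitVec β) w := by
  simp only [inner_unitVec, sin_sub]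
  ring

/-! ### Closed convex curves -/

lemma isOpen_enclosed {γ : Set ℂ} (hγ : IsClosed γ) : IsOpen (enclosed γ) := by
  rw [isOpen_iff_mem_nhds]
  intro z hz
  have ho : IsOpen (connectedComponentIn γᶜ z) := hγ.isOpen_compl.connectedComponentIn
  filter_upwards [ho.mem_nhds (mem_connectedComponentIn hz.1)] with y hy
  refine ⟨connectedComponentIn_subset _ _ hy, ?_⟩
  rw [← connectedComponentIn_eq hy]
  exact hz.2

lemma not_isBounded_ray {z : ℂ} (hz : z ≠ 0) :
    ¬ Bornology.IsBounded ((fun s : ℝ => s • z) '' Ici 1) := by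
  rw [isBounded_iff_forall_norm_le]
  rintro ⟨C, hC⟩
  have hz' : 0 < ‖z‖ := norm_pos_iff.2 hz
  have := hC _ ⟨1 + |C| / ‖z‖, by simp only [mem_Ici]; nlinarith [div_nonneg (abs_nonneg C) hz'.le], rfl⟩
  simp only [norm_smul, norm_eq_abs] at this
  rw [abs_of_nonneg (by positivity), add_mul, div_mul_cancel₀ _ hz'.ne'] at this
  linarith [le_abs_self C]

lemma isBounded_closedRegion {γ : Set ℂ} (hγ : IsCompact γ) :
    Bornology.IsBounded (closedRegion γ) := by
  obtain ⟨R, hR⟩ := isBounded_iff_forall_norm_le.1 hγ.isBounded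
  refine isBounded_iff_forall_norm_le.2 ⟨max R 0, ?_⟩
  rintro z (hz | hz)
  · by_contra! hlt
    have hz0 : z ≠ 0 := norm_pos_iff.1 ((le_max_right _ _).trans_lt hlt)
    refine not_isBounded_ray hz0 (hz.2.subset (IsPreconnected.subset_connectedComponentIn ?_ ?_ ?_))
    · exact isPreconnected_Ici.image _ (by fun_prop)
    · exact ⟨1, by simp, by simp⟩
    · rintro _ ⟨s, hs, rfl⟩ hmem
      have h1 := hR _ hmem
      simp only [norm_smul, norm_eq_abs] at h1
      rw [abs_of_nonneg (zero_le_one.trans hs)] at h1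
      have h2 : ‖z‖ ≤ s * ‖z‖ := le_mul_of_one_le_left (norm_nonneg _) hs
      linarith [le_max_left R 0]
  · exact (hR z hz).trans (le_max_left _ _)

namespace IsConvexCurve

lemma isClosed_closedRegion {γ : Set ℂ} (hγ : IsConvexCurve γ) : IsClosed (closedRegion γ) := by
  rw [← frontier_subset_iff_isClosed, hγ.frontier_eq]
  exact subset_union_right

lemma isCompact_closedRegion {γ : Set ℂ} (hγ : IsConvexCurve γ) : IsCompact (closedRegion γ) :=
  Metric.isCompact_of_isClosed_isBounded hγ.isClosed_closedRegion
    (isBounded_closedRegion hγ.isCompact)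

lemma interior_closedRegion {γ : Set ℂ} (hγ : IsConvexCurve γ) : interior (closedRegion γ) = enclosed γ := by
  rw [← self_sdiff_frontier, hγ.frontier_eq]
  ext z
  constructor
  · rintro ⟨h | h, h'⟩
    · exact h
    · exact absurd h h'
  · exact fun h => ⟨Or.inl h, h.1⟩

lemma convex_enclosed {γ : Set ℂ} (hγ : IsConvexCurve γ) : Convex ℝ (enclosed γ) :=
  hγ.interior_closedRegion ▸ hγ.convex.interior

/-- A closed convex curve inside an open convex set bounds a region inside that set. -/
lemma closedRegion_subset {γ C : Set ℂ} (hγ : IsConvexCurve γ) (hC : Convex ℝ C) (hCo : IsOpen C) (h : γ ⊆ C) :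
    closedRegion γ ⊆ C := by
  intro z hz
  by_contra hzC
  obtain ⟨f, hf⟩ := geometric_hahn_banach_open_point hC hCo hzC
  obtain ⟨m, hm, hmax⟩ := hγ.isCompact_closedRegion.exists_isMaxOn ⟨z, hz⟩ f.continuous.continuousOn
  have hlt : ∀ c ∈ C, f c < f m := fun c hc => (hf c hc).trans_le (hmax hz)
  obtain ⟨c, hc⟩ := hγ.nonempty
  have hmi : m ∉ interior (closedRegion γ) := by
    intro hi
    have h0 := (hmax.isLocalMax (mem_interior_iff_mem_nhds.1 hi)).hasFDerivAt_eq_zero f.hasFDerivAt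
    have := hlt c (h hc)
    simp [h0] at this
  have hmγ : m ∈ γ := by
    rw [hγ.interior_closedRegion] at hmi
    exact hm.resolve_left hmi
  exact lt_irrefl _ (hlt m (h hmγ))

end IsConvexCurve

/-- A ray from an interior point of a compact set leaves it through its frontier. -/
lemma exists_mem_frontier_ray {L : Set ℂ} (hL : IsCompact L) {z d : ℂ} (hz : z ∈ interior L)
    (hd : d ≠ 0) : ∃ s : ℝ, 0 < s ∧ z + s • d ∈ frontier L := by
  have hpre : IsPreconnected ((fun s : ℝ => z + s • d) '' Ici 0) :=
    isPreconnected_Ici.image _ (by fun_prop)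
  have h1 : ((fun s : ℝ => z + s • d) '' Ici 0 ∩ interior L).Nonempty :=
    ⟨z, ⟨0, by simp, by simp⟩, hz⟩
  obtain ⟨C, hC⟩ := isBounded_iff_forall_norm_le.1 hL.isBounded
  have h2 : ((fun s : ℝ => z + s • d) '' Ici 0 ∩ Lᶜ).Nonempty := by
    have hd' : 0 < ‖d‖ := norm_pos_iff.2 hd
    have hs : 0 ≤ (|C| + ‖z‖ + 1) / ‖d‖ := by positivity
    refine ⟨_, ⟨(|C| + ‖z‖ + 1) / ‖d‖, hs, rfl⟩, fun hmem => ?_⟩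
    have h3 := hC _ hmem
    have h4 : ‖((|C| + ‖z‖ + 1) / ‖d‖) • d‖ ≤ ‖z + ((|C| + ‖z‖ + 1) / ‖d‖) • d‖ + ‖z‖ := by
      have := norm_sub_le (z + ((|C| + ‖z‖ + 1) / ‖d‖) • d) z
      simpa using this
    rw [norm_smul, norm_eq_abs, abs_of_nonneg hs, div_mul_cancel₀ _ hd'.ne'] at h4
    linarith [le_abs_self C]
  by_contra! hno
  have hsub : (fun s : ℝ => z + s • d) '' Ici 0 ⊆ interior L ∪ Lᶜ := by
    rintro _ ⟨s, hs, rfl⟩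
    by_cases hi : z + s • d ∈ interior L
    · exact Or.inl hi
    · refine Or.inr fun hmem => ?_
      rcases (mem_Ici.1 hs).eq_or_lt with rfl | hs
      · simp only [zero_smul, add_zero] at hi
        exact hi hz
      · exact hno s hs ⟨subset_closure hmem, hi⟩
  obtain ⟨y, -, hy1, hy2⟩ := hpre _ _ isOpen_interior hL.isClosed.isOpen_compl hsub h1 h2
  exact hy2 (interior_subset hy1)

/-! ### Outward normals of the table -/

/-- `ψ` is the angle of an outward normal of `L` at `P`. -/
def IsOutwardNormal (L : Set ℂ) (P : ℂ) (ψ : ℝ) : Prop :=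
  ∀ z ∈ L, inner ℝ (unitVec ψ) (z - P) ≤ 0

/-- An outward normal is strictly obtuse to directions towards interior points. -/
lemma IsOutwardNormal.inner_neg {L : Set ℂ} {P : ℂ} {ψ : ℝ} (h : IsOutwardNormal L P ψ)
    {z : ℂ} (hz : z ∈ interior L) : inner ℝ (unitVec ψ) (z - P) < 0 := by
  obtain ⟨ε, hε, hball⟩ := Metric.mem_nhds_iff.1 (mem_interior_iff_mem_nhds.1 hz)
  have hmem : z + (ε / 2) • unitVec ψ ∈ L := by
    apply hball
    rw [Metric.mem_ball, dist_eq_norm, add_sub_cancel_left, norm_smul, norm_unitVec, mul_one,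
      norm_eq_abs, abs_of_pos (half_pos hε)]
    exact half_lt_self hε
  have := h _ hmem
  rw [add_sub_right_comm, inner_add_right, inner_smul_right, real_inner_self_eq_norm_sq,
    norm_unitVec] at this
  linarith

lemma IsOutwardNormal.congr {L : Set ℂ} {P : ℂ} {ψ ψ' : ℝ} (h : IsOutwardNormal L P ψ)
    (he : unitVec ψ' = unitVec ψ) : IsOutwardNormal L P ψ' := by
  intro z hz
  rw [he]
  exact h z hz

lemma exists_isOutwardNormal {L : Set ℂ} (hL : Convex ℝ L)
    (hi : (interior L).Nonempty) {P : ℂ} (hP : P ∈ frontier L) :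
    ∃ ψ, IsOutwardNormal L P ψ := by
  obtain ⟨f, hf⟩ := geometric_hahn_banach_open_point hL.interior isOpen_interior hP.2
  obtain ⟨c, hci⟩ := hi
  set w : ℂ := (InnerProductSpace.toDual ℝ ℂ).symm f with hw
  have hfw : ∀ z, f z = inner ℝ w z := fun z => by
    rw [hw, InnerProductSpace.toDual_symm_apply]
  have hw0 : w ≠ 0 := by
    intro h0
    have := hf c hci
    simp [hfw, h0] at this
  obtain ⟨ψ, hψ⟩ := exists_unitVec w
  refine ⟨ψ, fun z hz => ?_⟩
  have hle : f z ≤ f P := by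
    have hcl : L ⊆ closure (interior L) := by
      rw [hL.closure_interior_eq_closure_of_nonempty_interior ⟨c, hci⟩]
      exact subset_closure
    exact closure_minimal (fun y hy => (hf y hy).le) (isClosed_le f.continuous continuous_const)
      (hcl hz)
  have h1 : inner ℝ w (z - P) ≤ 0 := by
    rw [← hfw, map_sub]; linarith
  rw [hψ, real_inner_smul_left] at h1
  exact nonpos_of_mul_nonpos_right h1 (norm_pos_iff.2 hw0)

namespace IsTable

lemma differentiable {Γ : ℝ → ℂ} (hΓ : IsTable Γ) : Differentiable ℝ Γ :=
  hΓ.contDiff.differentiable one_ne_zero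

lemma mem_frontier {Γ : ℝ → ℂ} (hΓ : IsTable Γ) (t : ℝ) :
    Γ t ∈ frontier (closedRegion (range Γ)) := by
  rw [hΓ.convex.frontier_eq]
  exact mem_range_self t

lemma mem_closedRegion (Γ : ℝ → ℂ) (t : ℝ) : Γ t ∈ closedRegion (range Γ) :=
  Or.inr (mem_range_self t)

lemma exists_normal {Γ : ℝ → ℂ} (hΓ : IsTable Γ) (hne : (enclosed (range Γ)).Nonempty) (t : ℝ) :
    ∃ ψ, IsOutwardNormal (closedRegion (range Γ)) (Γ t) ψ :=
  exists_isOutwardNormal hΓ.convex.convex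
    (hΓ.convex.interior_closedRegion.symm ▸ hne) (hΓ.mem_frontier t)

lemma inner_normal_neg {Γ : ℝ → ℂ} (hΓ : IsTable Γ) {t ψ : ℝ}
    (h : IsOutwardNormal (closedRegion (range Γ)) (Γ t) ψ) {z : ℂ}
    (hz : z ∈ enclosed (range Γ)) : inner ℝ (unitVec ψ) (z - Γ t) < 0 :=
  h.inner_neg (hΓ.convex.interior_closedRegion.symm ▸ hz)

lemma inner_normal_deriv {Γ : ℝ → ℂ} (hΓ : IsTable Γ) {t ψ : ℝ}
    (h : IsOutwardNormal (closedRegion (range Γ)) (Γ t) ψ) :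
    inner ℝ (unitVec ψ) (deriv Γ t) = 0 := by
  have hd : HasDerivAt (fun s => inner ℝ (unitVec ψ) (Γ s)) (inner ℝ (unitVec ψ) (deriv Γ t)) t := by
    simpa using (hasDerivAt_const t (unitVec ψ)).inner ℝ (hΓ.differentiable t).hasDerivAt
  refine IsLocalMax.hasDerivAt_eq_zero (Filter.Eventually.of_forall fun s => ?_) hd
  have := h _ (mem_closedRegion Γ s)
  rw [inner_sub_right] at this
  simpa using this

/-- The billiard reflection at a boundary point, in terms of the outward normal there. -/
lemma billiardMap {Γ : ℝ → ℂ} (hΓ : IsTable Γ) {t ψ φ s : ℝ} {z : ℂ}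
    (h : IsOutwardNormal (closedRegion (range Γ)) (Γ t) ψ) (hz : z ∈ enclosed (range Γ))
    (hs : 0 < s) (p q : ℝ) (he : Γ t - z = s • lineDir (p, φ))
    (hp : inner ℝ (unitVec φ) (Γ t) = p) (hq : inner ℝ (unitVec (2 * ψ - φ)) (Γ t) = q) :
    BilliardMap Γ (p, φ) (q, 2 * ψ - φ) := by
  refine ⟨t, hp, ⟨s, hs, ?_⟩, hq, ?_⟩
  · rw [← he, sub_sub_cancel]
    exact hz
  · exact (reflection_lineDir (hΓ.deriv_ne_zero t) (hΓ.inner_normal_deriv h) _ _ _).symm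

lemma deriv_eq {Γ : ℝ → ℂ} (hΓ : IsTable Γ) {t u : ℝ} (h : Γ t = Γ u) :
    deriv Γ t = deriv Γ u := by
  have hp : ∀ x, deriv Γ (Int.fract x) = deriv Γ x ∧ Γ (Int.fract x) = Γ x := by
    intro x
    have hx : ∀ y, Γ (y - ⌊x⌋) = Γ y := by
      intro y
      simpa using hΓ.periodic.sub_int_mul_eq (x := y) ⌊x⌋
    refine ⟨?_, hx x⟩
    have h1 := deriv_comp_sub_const (f := Γ) (⌊x⌋ : ℝ) x
    rw [funext hx] at h1
    exact h1.symm
  have hm : ∀ x : ℝ, Int.fract x ∈ Ico (0 : ℝ) 1 := fun x => ⟨Int.fract_nonneg x, Int.fract_lt_one x⟩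
  have : Int.fract t = Int.fract u :=
    hΓ.injOn (hm t) (hm u) (by rw [(hp t).2, (hp u).2, h])
  rw [← (hp t).1, ← (hp u).1, this]

/-- The exit point of an oriented line that crosses the interior is unique. -/
lemma exit_unique {Γ : ℝ → ℂ} (hΓ : IsTable Γ) {t u : ℝ} {d : ℂ} {s s' r : ℝ}
    (hs : 0 < s) (h : Γ t - s • d ∈ enclosed (range Γ))
    (hs' : 0 < s') (h' : Γ u - s' • d ∈ enclosed (range Γ)) (hr : Γ u = Γ t + r • d) : r = 0 := by
  have key : ∀ {t u : ℝ} {s r : ℝ}, 0 < s → Γ t - s • d ∈ enclosed (range Γ) →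
      Γ u = Γ t + r • d → r ≤ 0 := by
    intro t u s r hs h hr
    by_contra! hpos
    have hmem : Γ t ∈ enclosed (range Γ) := by
      rw [← hΓ.convex.interior_closedRegion] at h ⊢
      refine hΓ.convex.convex.openSegment_interior_self_subset_interior h
        (mem_closedRegion Γ u) ⟨r / (s + r), s / (s + r), by positivity, by positivity,
          by field_simp; ring, ?_⟩
      rw [hr]
      have e : (r / (s + r)) + s / (s + r) = 1 := by field_simp; ring
      have e2 : (r / (s + r)) * s = s / (s + r) * r := by ring
      calc (r / (s + r)) • (Γ t - s • d) + (s / (s + r)) • (Γ t + r • d)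
          = (r / (s + r) + s / (s + r)) • Γ t + (s / (s + r) * r - r / (s + r) * s) • d := by
            module
        _ = Γ t := by rw [e, e2]; simp
    exact hmem.1 (mem_range_self t)
  refine le_antisymm (key hs h hr) ?_
  have := key (u := t) (r := -r) hs' h' (by rw [hr]; module)
  linarith

end IsTable

lemma exists_eq_add_smul_lineDir {ℓ : ℝ × ℝ} {z w : ℂ} (hz : z ∈ line ℓ) (hw : w ∈ line ℓ) :
    ∃ r : ℝ, w = z + r • lineDir ℓ := by
  have h : inner ℝ (unitVec ℓ.2) (w - z) = 0 := by
    rw [inner_sub_right, hw, hz, sub_self]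
  rw [inner_unitVec, Complex.sub_re, Complex.sub_im] at h
  refine ⟨-sin ℓ.2 * (w.re - z.re) + cos ℓ.2 * (w.im - z.im), ?_⟩
  have h1 := sin_sq_add_cos_sq ℓ.2
  apply Complex.ext
  · rw [Complex.add_re, Complex.smul_re, lineDir_re, smul_eq_mul]
    linear_combination cos ℓ.2 * h - (w.re - z.re) * h1
  · rw [Complex.add_im, Complex.smul_im, lineDir_im, smul_eq_mul]
    linear_combination sin ℓ.2 * h - (w.im - z.im) * h1

lemma BilliardLift.angle_unique {Γ : ℝ → ℂ} (hΓ : IsTable Γ) {ℓ ℓ₁ ℓ₂ : ℝ × ℝ}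
    (h₁ : BilliardLift Γ ℓ ℓ₁) (h₂ : BilliardLift Γ ℓ ℓ₂) : ℓ₁.2 = ℓ₂.2 := by
  obtain ⟨⟨t, ht, ⟨s, hs, hst⟩, -, hd₁⟩, hl₁, hu₁⟩ := h₁
  obtain ⟨⟨u, hu, ⟨s', hs', hsu⟩, -, hd₂⟩, hl₂, hu₂⟩ := h₂
  obtain ⟨r, hr⟩ := exists_eq_add_smul_lineDir ht hu
  have hr0 := hΓ.exit_unique hs hst hs' hsu hr
  rw [hr0, zero_smul, add_zero] at hr
  have hd : lineDir ℓ₁ = lineDir ℓ₂ := by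
    rw [hd₁, hd₂]
    simp only [hΓ.deriv_eq hr]
  have h := mul_left_cancel₀ Complex.I_ne_zero hd
  obtain ⟨n, hn⟩ := unitVec_eq_iff.1 h
  have hπ := pi_pos
  have hn1 : (n : ℝ) < 1 := by by_contra! hc; nlinarith
  have hn2 : (-1 : ℝ) < n := by by_contra! hc; nlinarith
  have : n = 0 := by
    have h1 : n < 1 := by exact_mod_cast hn1
    have h2 : -1 < n := by exact_mod_cast hn2
    omega
  rw [this] at hn
  simpa using hn

/-! ### Reflection of supporting lines -/

lemma inner_unitVec_add_pi_div_two (ψ : ℝ) (w : ℂ) :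
    inner ℝ (unitVec (ψ + π / 2)) w = -sin ψ * w.re + cos ψ * w.im := by
  rw [inner_unitVec, cos_add_pi_div_two, sin_add_pi_div_two]

lemma sq_add_sq_inner_unitVec (ψ : ℝ) (w : ℂ) :
    inner ℝ (unitVec ψ) w ^ 2 + inner ℝ (unitVec (ψ + π / 2)) w ^ 2 = ‖w‖ ^ 2 := by
  rw [inner_unitVec_add_pi_div_two, inner_unitVec, Complex.sq_norm, Complex.normSq_apply]
  linear_combination (w.re ^ 2 + w.im ^ 2) * sin_sq_add_cos_sq ψ

/-- The side of a line through `P` and `z` in an orthonormal frame. -/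
lemma smul_inner_unitVec {P z : ℂ} {s p φ : ℝ} (he : P - z = s • lineDir (p, φ)) (ψ : ℝ) (w : ℂ) :
    s * inner ℝ (unitVec φ) w =
      inner ℝ (unitVec ψ) (z - P) * inner ℝ (unitVec (ψ + π / 2)) w -
        inner ℝ (unitVec (ψ + π / 2)) (z - P) * inner ℝ (unitVec ψ) w := by
  have h1 := congrArg Complex.re he
  have h2 := congrArg Complex.im he
  simp only [Complex.sub_re, Complex.sub_im, Complex.smul_re, Complex.smul_im, lineDir_re,
    lineDir_im, smul_eq_mul] at h1 h2
  simp only [inner_unitVec, cos_add_pi_div_two, sin_add_pi_div_two, Complex.sub_re, Complex.sub_im]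
  linear_combination (-w.re) * h2 + w.im * h1 - ((z.re - P.re) * w.im - (z.im - P.im) * w.re) *
    sin_sq_add_cos_sq ψ

/-- The side of the reflected line in an orthonormal frame adapted to the mirror. -/
lemma smul_inner_unitVec_reflect {P z : ℂ} {s p φ : ℝ} (he : P - z = s • lineDir (p, φ))
    (ψ : ℝ) (w : ℂ) :
    s * inner ℝ (unitVec (2 * ψ - φ)) w =
      -(inner ℝ (unitVec ψ) (z - P) * inner ℝ (unitVec (ψ + π / 2)) w +
        inner ℝ (unitVec (ψ + π / 2)) (z - P) * inner ℝ (unitVec ψ) w) := by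
  have h := inner_unitVec_add_reflect φ ψ w
  have h0 := smul_inner_unitVec he ψ w
  have h1 := congrArg Complex.re he
  have h2 := congrArg Complex.im he
  simp only [Complex.sub_re, Complex.sub_im, Complex.smul_re, Complex.smul_im, lineDir_re,
    lineDir_im, smul_eq_mul] at h1 h2
  have h3 : s * cos (ψ - φ) = -inner ℝ (unitVec (ψ + π / 2)) (z - P) := by
    rw [cos_sub, inner_unitVec_add_pi_div_two, Complex.sub_re, Complex.sub_im]
    linear_combination (-cos ψ) * h2 + sin ψ * h1
  linear_combination s * h - h0 + 2 * inner ℝ (unitVec ψ) w * h3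

lemma isSupportingLine_iff (K : Set ℂ) (φ : ℝ) (P : ℂ) :
    IsSupportingLine K (inner ℝ (unitVec φ) P, φ) ↔
      (∃ z ∈ K, inner ℝ (unitVec φ) (z - P) = 0) ∧
        ((∀ z ∈ K, inner ℝ (unitVec φ) (z - P) ≤ 0) ∨
          ∀ z ∈ K, 0 ≤ inner ℝ (unitVec φ) (z - P)) := by
  simp only [inner_sub_right, sub_eq_zero, sub_nonpos, sub_nonneg]
  rfl

namespace IsConvexCaustic

lemma closedRegion_subset_enclosed {Γ : ℝ → ℂ} {γ : Set ℂ} (hΓ : IsTable Γ)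
    (hγ : IsConvexCaustic Γ γ) : closedRegion γ ⊆ enclosed (range Γ) :=
  hγ.isConvexCurve.closedRegion_subset hΓ.convex.convex_enclosed
    (isOpen_enclosed hΓ.convex.isCompact.isClosed) hγ.subset

lemma closedRegion_nonempty {Γ : ℝ → ℂ} {γ : Set ℂ} (hγ : IsConvexCaustic Γ γ) :
    (closedRegion γ).Nonempty :=
  hγ.isConvexCurve.nonempty.mono subset_union_right

lemma enclosed_nonempty {Γ : ℝ → ℂ} {γ : Set ℂ} (hγ : IsConvexCaustic Γ γ) :
    (enclosed (range Γ)).Nonempty :=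
  hγ.isConvexCurve.nonempty.mono hγ.subset

lemma inner_normal_neg {Γ : ℝ → ℂ} {γ : Set ℂ} (hΓ : IsTable Γ) (hγ : IsConvexCaustic Γ γ)
    {t ψ : ℝ} (h : IsOutwardNormal (closedRegion (range Γ)) (Γ t) ψ) {z : ℂ}
    (hz : z ∈ closedRegion γ) : inner ℝ (unitVec ψ) (z - Γ t) < 0 :=
  hΓ.inner_normal_neg h (hγ.closedRegion_subset_enclosed hΓ hz)

lemma reflect_supporting {Γ : ℝ → ℂ} {γ : Set ℂ} (hΓ : IsTable Γ) (hγ : IsConvexCaustic Γ γ)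
    {t ψ φ s p : ℝ} {z : ℂ} (h : IsOutwardNormal (closedRegion (range Γ)) (Γ t) ψ)
    (hz : z ∈ closedRegion γ) (hs : 0 < s) (he : Γ t - z = s • lineDir (p, φ))
    (hside : (∀ w ∈ closedRegion γ, inner ℝ (unitVec φ) (w - Γ t) ≤ 0) ∨
      ∀ w ∈ closedRegion γ, 0 ≤ inner ℝ (unitVec φ) (w - Γ t)) :
    (∃ w ∈ closedRegion γ, inner ℝ (unitVec (2 * ψ - φ)) (w - Γ t) = 0) ∧
      ((∀ w ∈ closedRegion γ, inner ℝ (unitVec (2 * ψ - φ)) (w - Γ t) ≤ 0) ∨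
        ∀ w ∈ closedRegion γ, 0 ≤ inner ℝ (unitVec (2 * ψ - φ)) (w - Γ t)) := by
  rw [← isSupportingLine_iff]
  refine hγ.reflect (inner ℝ (unitVec φ) (Γ t), φ) _ ((isSupportingLine_iff _ _ _).2
    ⟨⟨z, hz, ?_⟩, hside⟩) (hΓ.billiardMap h (hγ.closedRegion_subset_enclosed hΓ hz) hs _ _ he
      rfl rfl)
  rw [← neg_sub, inner_neg_right, he, inner_smul_right, inner_unitVec_lineDir]
  simp

/-- A caustic lies on any supporting line that hits the table perpendicularly. -/
lemma inner_eq_zero_of_perpendicular {Γ : ℝ → ℂ} {γ : Set ℂ} (hΓ : IsTable Γ)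
    (hγ : IsConvexCaustic Γ γ) {t ψ : ℝ}
    (h : IsOutwardNormal (closedRegion (range Γ)) (Γ t) ψ)
    (hside : ∀ w ∈ closedRegion γ, 0 ≤ inner ℝ (unitVec (ψ + π / 2)) (w - Γ t)) :
    ∀ w ∈ closedRegion γ, inner ℝ (unitVec (ψ + π / 2)) (w - Γ t) = 0 := by
  have hneg : ∀ w ∈ closedRegion γ, inner ℝ (unitVec ψ) (w - Γ t) < 0 :=
    fun w hw => hγ.inner_normal_neg hΓ h hw
  obtain ⟨m, hm, hmax⟩ := hγ.isConvexCurve.isCompact_closedRegion.exists_isMinOn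
    hγ.closedRegion_nonempty (f := fun w => inner ℝ (unitVec (ψ + π / 2)) (w - Γ t) /
      inner ℝ (unitVec ψ) (w - Γ t))
    (ContinuousOn.div (by fun_prop) (by fun_prop) fun w hw => (hneg w hw).ne)
  have hbm := hneg m hm
  have hcomp : ∀ w ∈ closedRegion γ, inner ℝ (unitVec (ψ + π / 2)) (m - Γ t) *
      inner ℝ (unitVec ψ) (w - Γ t) ≤ inner ℝ (unitVec ψ) (m - Γ t) *
        inner ℝ (unitVec (ψ + π / 2)) (w - Γ t) := by
    intro w hw
    have h1 : inner ℝ (unitVec (ψ + π / 2)) (m - Γ t) / inner ℝ (unitVec ψ) (m - Γ t) ≤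
      inner ℝ (unitVec (ψ + π / 2)) (w - Γ t) / inner ℝ (unitVec ψ) (w - Γ t) := hmax hw
    have h2 := mul_le_mul_of_nonneg_right h1 (mul_pos_of_neg_of_neg hbm (hneg w hw)).le
    have hbw := hneg w hw
    generalize inner ℝ (unitVec ψ) (w - Γ t) = bw at *
    generalize inner ℝ (unitVec ψ) (m - Γ t) = bm at *
    rwa [← mul_assoc, div_mul_cancel₀ _ hbm.ne, mul_left_comm, div_mul_cancel₀ _ hbw.ne] at h2
  rcases (hside m hm).eq_or_lt with h0 | hpos
  · intro w hw
    have h1 := hcomp w hw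
    rw [← h0, zero_mul] at h1
    exact le_antisymm (nonpos_of_mul_nonneg_right h1 hbm) (hside w hw)
  · exfalso
    have hne : Γ t - m ≠ 0 := by
      intro h0
      rw [← neg_sub, h0] at hbm
      simp at hbm
    obtain ⟨φ, hφ⟩ := exists_lineDir (Γ t - m)
    have hs : 0 < ‖Γ t - m‖ := norm_pos_iff.2 hne
    obtain ⟨⟨w, hw, hw0⟩, -⟩ := hγ.reflect_supporting hΓ h hm hs (hφ 0)
      (Or.inr fun w hw => by
        have h1 := smul_inner_unitVec (hφ 0) ψ (w - Γ t)
        have h2 := hcomp w hw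
        refine nonneg_of_mul_nonneg_right (a := ‖Γ t - m‖) ?_ hs
        rw [h1]
        linarith)
    have h1 := smul_inner_unitVec_reflect (hφ 0) ψ (w - Γ t)
    rw [hw0, mul_zero] at h1
    have h2 := mul_nonpos_of_nonpos_of_nonneg hbm.le (hside w hw)
    have h3 := mul_neg_of_pos_of_neg hpos (hneg w hw)
    linarith

end IsConvexCaustic

/-! ### Reflection of the tangent lines of a caustic -/

/-- The oriented lines at angles `φ` and `2ψ - φ` through the boundary point `P` of `L`, where
`ψ` is the angle of an outward normal, both touch `K` and keep it on the left. -/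
structure Bounce (K L : Set ℂ) (φ ψ : ℝ) (P : ℂ) : Prop where
  lt : φ < ψ
  le : ψ ≤ φ + π / 2
  mem : P ∈ L
  normal : IsOutwardNormal L P ψ
  neg : ∀ z ∈ K, inner ℝ (unitVec ψ) (z - P) < 0
  left_in : ∀ z ∈ K, inner ℝ (unitVec φ) (z - P) ≤ 0
  touch_in : ∃ z ∈ K, inner ℝ (unitVec φ) (z - P) = 0
  left_out : ∀ z ∈ K, inner ℝ (unitVec (2 * ψ - φ)) (z - P) ≤ 0
  touch_out : ∃ z ∈ K, inner ℝ (unitVec (2 * ψ - φ)) (z - P) = 0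

/-- A representative in `(φ, φ + π)` of an angle with positive sine relative to `φ`. -/
lemma exists_angle {φ ψ₀ : ℝ} (h : 0 < sin (ψ₀ - φ)) :
    ∃ ψ, unitVec ψ = unitVec ψ₀ ∧ φ < ψ ∧ ψ < φ + π := by
  have hp : (0 : ℝ) < 2 * π := two_pi_pos
  have hm := toIocMod_mem_Ioc hp φ ψ₀
  have he : ψ₀ = toIocMod hp φ ψ₀ + toIocDiv hp φ ψ₀ * (2 * π) := by
    simp
  refine ⟨toIocMod hp φ ψ₀, unitVec_eq_iff.2 ⟨-toIocDiv hp φ ψ₀, ?_⟩, hm.1, ?_⟩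
  · push_cast
    linarith
  · by_contra! hge
    have h2 : sin (toIocMod hp φ ψ₀ - φ) = sin (ψ₀ - φ) := by
      conv_rhs => rw [he, add_sub_right_comm, sin_add_int_mul_two_pi]
    have h3 : sin (toIocMod hp φ ψ₀ - φ - 2 * π) ≤ 0 :=
      sin_nonpos_of_nonpos_of_neg_pi_le (by linarith [hm.2]) (by linarith)
    rw [sin_sub_two_pi] at h3
    linarith

theorem IsConvexCaustic.exists_bounce {Γ : ℝ → ℂ} {γ : Set ℂ} (hΓ : IsTable Γ)
    (hγ : IsConvexCaustic Γ γ) (φ : ℝ) :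
    ∃ ψ P, Bounce (closedRegion γ) (closedRegion (range Γ)) φ ψ P ∧
      BilliardLift Γ (inner ℝ (unitVec φ) P, φ)
        (inner ℝ (unitVec (2 * ψ - φ)) P, 2 * ψ - φ) := by
  obtain ⟨z, hz, hmax⟩ := hγ.isConvexCurve.isCompact_closedRegion.exists_isMaxOn
    hγ.closedRegion_nonempty (f := fun w => inner ℝ (unitVec φ) w) (by fun_prop)
  have hze := hγ.closedRegion_subset_enclosed hΓ hz
  obtain ⟨s, hs, hsf⟩ := exists_mem_frontier_ray hΓ.convex.isCompact_closedRegion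
    (hΓ.convex.interior_closedRegion.symm ▸ hze) (lineDir_ne_zero (0, φ))
  rw [hΓ.convex.frontier_eq] at hsf
  obtain ⟨t, ht⟩ := hsf
  have he : Γ t - z = s • lineDir (0, φ) := by rw [ht, add_sub_cancel_left]
  have hz0 : inner ℝ (unitVec φ) (z - Γ t) = 0 := by
    rw [← neg_sub, inner_neg_right, he, inner_smul_right, inner_unitVec_lineDir]
    simp
  have hleft : ∀ w ∈ closedRegion γ, inner ℝ (unitVec φ) (w - Γ t) ≤ 0 := by
    intro w hw
    have h1 : inner ℝ (unitVec φ) w ≤ inner ℝ (unitVec φ) z := hmax hw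
    rw [inner_sub_right] at hz0 ⊢
    linarith
  obtain ⟨ψ₀, hψ₀⟩ := hΓ.exists_normal hγ.enclosed_nonempty t
  obtain ⟨ψ, hψ, hl, hu⟩ : ∃ ψ, unitVec ψ = unitVec ψ₀ ∧ φ < ψ ∧ ψ < φ + π := by
    apply exists_angle
    have h1 := hγ.inner_normal_neg hΓ hψ₀ hz
    rw [← neg_sub, inner_neg_right, he, inner_smul_right, inner_unitVec_lineDir] at h1
    exact pos_of_mul_pos_right (by linarith) hs.le
  have hn : IsOutwardNormal (closedRegion (range Γ)) (Γ t) ψ := hψ₀.congr hψ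
  have hneg : ∀ w ∈ closedRegion γ, inner ℝ (unitVec ψ) (w - Γ t) < 0 :=
    fun w hw => hγ.inner_normal_neg hΓ hn hw
  obtain ⟨⟨y, hy, hy0⟩, hside⟩ := hγ.reflect_supporting hΓ hn hz hs he (Or.inl hleft)
  have hsum := inner_unitVec_add_reflect φ ψ
  have hπ := pi_pos
  suffices hle : ∀ w ∈ closedRegion γ, inner ℝ (unitVec (2 * ψ - φ)) (w - Γ t) ≤ 0 by
    have hcos : 0 ≤ cos (ψ - φ) := by
      by_contra! hc
      have h1 := hsum (z - Γ t)
      rw [hz0, zero_add] at h1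
      have h2 := mul_pos_of_neg_of_neg hc (hneg z hz)
      have h3 := hle z hz
      linarith
    refine ⟨ψ, Γ t, ⟨hl, ?_, IsTable.mem_closedRegion Γ t, hn, hneg, hleft, ⟨z, hz, hz0⟩, hle,
      ⟨y, hy, hy0⟩⟩, hΓ.billiardMap hn hze hs _ _ he rfl rfl, ?_, ?_⟩
    · by_contra! hc
      have := cos_neg_of_pi_div_two_lt_of_lt (x := ψ - φ) (by linarith) (by linarith)
      linarith
    · dsimp only; linarith
    · dsimp only; linarith
  rcases hside with hside | hside
  · exact hside
  have hc1 : cos (ψ - φ) ≤ 0 := by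
    by_contra! hc
    have h1 := hsum (z - Γ t)
    rw [hz0, zero_add] at h1
    have h2 := mul_neg_of_pos_of_neg hc (hneg z hz)
    have h3 := hside z hz
    linarith
  have hc2 : 0 ≤ cos (ψ - φ) := by
    by_contra! hc
    have h1 := hsum (y - Γ t)
    rw [hy0, add_zero] at h1
    have h2 := mul_pos_of_neg_of_neg hc (hneg y hy)
    have h3 := hleft y hy
    linarith
  have hφ : ψ = φ + π / 2 := by
    rcases lt_trichotomy (ψ - φ) (π / 2) with h | h | h
    · have := cos_pos_of_mem_Ioo (x := ψ - φ) ⟨by linarith, h⟩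
      linarith
    · linarith
    · have := cos_neg_of_pi_div_two_lt_of_lt (x := ψ - φ) h (by linarith)
      linarith
  have hout : unitVec (2 * ψ - φ) = unitVec (ψ + π / 2) := by
    congr 1
    rw [hφ]; ring
  rw [hout] at hside ⊢
  exact fun w hw => (hγ.inner_eq_zero_of_perpendicular hΓ hn hside w hw).le

namespace Bounce

/-- All directions strictly between the two tangent lines separate `P` from `K`. -/
lemma inner_neg {K L : Set ℂ} {φ ψ χ : ℝ} {P : ℂ} (h : Bounce K L φ ψ P) (h₁ : φ < χ)
    (h₂ : χ < 2 * ψ - φ) {z : ℂ} (hz : z ∈ K) : inner ℝ (unitVec χ) (z - P) < 0 := by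
  have hπ := pi_pos
  have hl := h.lt
  have hu := h.le
  have hs : 0 < sin (ψ - φ) := sin_pos_of_pos_of_lt_pi (by linarith) (by linarith)
  rcases le_total χ ψ with hχ | hχ
  · have e := sin_mul_inner_unitVec φ ψ χ (z - P)
    have h3 : 0 ≤ sin (ψ - χ) := sin_nonneg_of_nonneg_of_le_pi (by linarith) (by linarith)
    have h4 : 0 < sin (χ - φ) := sin_pos_of_pos_of_lt_pi (by linarith) (by linarith)
    have h5 := mul_nonpos_of_nonneg_of_nonpos h3 (h.left_in z hz)
    have h6 := mul_neg_of_pos_of_neg h4 (h.neg z hz)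
    exact neg_of_mul_neg_right (a := sin (ψ - φ)) (by linarith) hs.le
  · have e := sin_mul_inner_unitVec ψ (2 * ψ - φ) χ (z - P)
    rw [show 2 * ψ - φ - ψ = ψ - φ by ring] at e
    have h3 : 0 < sin (2 * ψ - φ - χ) := sin_pos_of_pos_of_lt_pi (by linarith) (by linarith)
    have h4 : 0 ≤ sin (χ - ψ) := sin_nonneg_of_nonneg_of_le_pi (by linarith) (by linarith)
    have h5 := mul_nonpos_of_nonneg_of_nonpos h4 (h.left_out z hz)
    have h6 := mul_neg_of_pos_of_neg h3 (h.neg z hz)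
    exact neg_of_mul_neg_right (a := sin (ψ - φ)) (by linarith) hs.le

/-- The reflection is monotone on the tangent lines of a convex set. -/
theorem mono {K L : Set ℂ} {φ₁ φ₂ ψ₁ ψ₂ : ℝ} {P₁ P₂ : ℂ} (h₁ : Bounce K L φ₁ ψ₁ P₁)
    (h₂ : Bounce K L φ₂ ψ₂ P₂) (h : φ₁ ≤ φ₂) : 2 * ψ₁ - φ₁ ≤ 2 * ψ₂ - φ₂ := by
  by_contra! hlt
  have hl₂ := h₂.lt
  have hu₁ := h₁.le
  have hin : inner ℝ (unitVec φ₂) (P₁ - P₂) ≥ 0 := by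
    obtain ⟨z, hz, hz0⟩ := h₂.touch_in
    have h3 : inner ℝ (unitVec φ₂) (z - P₁) ≤ 0 := by
      rcases h.eq_or_lt with rfl | h'
      · exact h₁.left_in z hz
      · exact (h₁.inner_neg h' (by linarith) hz).le
    rw [← sub_sub_sub_cancel_left _ _ z, inner_sub_right]
    linarith
  have hout : inner ℝ (unitVec (2 * ψ₂ - φ₂)) (P₁ - P₂) > 0 := by
    obtain ⟨z, hz, hz0⟩ := h₂.touch_out
    have h3 := h₁.inner_neg (χ := 2 * ψ₂ - φ₂) (by linarith) hlt hz
    rw [← sub_sub_sub_cancel_left _ _ z, inner_sub_right]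
    linarith
  have hsum := inner_unitVec_add_reflect φ₂ ψ₂ (P₁ - P₂)
  have hcos : 0 < cos (ψ₂ - φ₂) := cos_pos_of_mem_Ioo ⟨by linarith [pi_pos], by linarith⟩
  have h3 := mul_nonpos_of_nonneg_of_nonpos hcos.le (h₂.normal P₁ h₁.mem)
  linarith

lemma unitVec_add_two_pi (φ : ℝ) : unitVec (φ + 2 * π) = unitVec φ :=
  unitVec_eq_iff.2 ⟨1, by simp⟩

lemma add_two_pi {K L : Set ℂ} {φ ψ : ℝ} {P : ℂ} (h : Bounce K L φ ψ P) :
    Bounce K L (φ + 2 * π) (ψ + 2 * π) P := by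
  have e : 2 * (ψ + 2 * π) - (φ + 2 * π) = 2 * ψ - φ + 2 * π := by ring
  refine ⟨by linarith [h.lt], by linarith [h.le], h.mem, h.normal.congr (unitVec_add_two_pi ψ),
    ?_, ?_, ?_, ?_, ?_⟩
  · rw [unitVec_add_two_pi]; exact h.neg
  · rw [unitVec_add_two_pi]; exact h.left_in
  · rw [unitVec_add_two_pi]; exact h.touch_in
  · rw [e, unitVec_add_two_pi]; exact h.left_out
  · rw [e, unitVec_add_two_pi]; exact h.touch_out

/-- If `K` contains a disc, then the angle of reflection is bounded away from a right angle. -/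
lemma le_cos {K L : Set ℂ} {φ ψ r D : ℝ} {P c : ℂ} (h : Bounce K L φ ψ P) (hr : 0 ≤ r)
    (hc : Metric.closedBall c r ⊆ K) (hD : ∀ z ∈ L, ‖z - c‖ ≤ D) (hD0 : 0 < D) :
    r / D ≤ cos (ψ - φ) := by
  have key : ∀ χ : ℝ, (∀ z ∈ K, inner ℝ (unitVec χ) (z - P) ≤ 0) →
      inner ℝ (unitVec χ) (c - P) ≤ -r := by
    intro χ hχ
    have h1 := hχ (c + r • unitVec χ) (hc (by
      rw [Metric.mem_closedBall, dist_eq_norm, add_sub_cancel_left, norm_smul, norm_unitVec,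
        mul_one, norm_eq_abs, abs_of_nonneg hr]))
    rw [add_sub_right_comm, inner_add_right, inner_smul_right, real_inner_self_eq_norm_sq,
      norm_unitVec] at h1
    linarith
  have h1 := key _ h.left_in
  have h2 := key _ h.left_out
  have h3 := inner_unitVec_add_reflect φ ψ (c - P)
  have h4 : |inner ℝ (unitVec ψ) (c - P)| ≤ D := by
    refine (abs_real_inner_le_norm _ _).trans ?_
    rw [norm_unitVec, one_mul, norm_sub_rev]
    exact hD P h.mem
  have h5 : 0 ≤ cos (ψ - φ) := cos_nonneg_of_neg_pi_div_two_le_of_le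
    (by linarith [h.lt, pi_pos]) (by linarith [h.le])
  rw [div_le_iff₀ hD0]
  nlinarith [neg_abs_le (inner ℝ (unitVec ψ) (c - P))]

/-- If `K` lies on the incoming line, the reflected line is the same line reversed. -/
lemma eq_of_subset_line {K L : Set ℂ} {φ ψ : ℝ} {P : ℂ} (h : Bounce K L φ ψ P)
    (hK : ∀ z ∈ K, ∀ w ∈ K, inner ℝ (unitVec φ) (z - w) = 0) : ψ = φ + π / 2 := by
  refine h.le.eq_or_lt.resolve_right fun hlt => ?_
  obtain ⟨y, hy, hy0⟩ := h.touch_in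
  obtain ⟨z, hz, hz0⟩ := h.touch_out
  have h1 := inner_unitVec_add_reflect φ ψ (z - P)
  have h2 := hK z hz y hy
  rw [← sub_sub_sub_cancel_right _ _ P, inner_sub_right, hy0, sub_zero] at h2
  have hcos : 0 < cos (ψ - φ) := cos_pos_of_mem_Ioo ⟨by linarith [pi_pos, h.lt], by linarith⟩
  have h3 := mul_neg_of_pos_of_neg hcos (h.neg z hz)
  linarith

end Bounce

/-! ### The rotation number -/

lemma mem_invariantCurve {γ : Set ℂ} {φ : ℝ} {P : ℂ}
    (h : ∀ z ∈ closedRegion γ, inner ℝ (unitVec φ) (z - P) ≤ 0)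
    (h' : ∃ z ∈ closedRegion γ, inner ℝ (unitVec φ) (z - P) = 0) :
    (inner ℝ (unitVec φ) P, φ) ∈ invariantCurve γ := by
  simp only [inner_sub_right, sub_nonpos, sub_eq_zero] at h h'
  exact ⟨h', h⟩

lemma eq_of_mem_invariantCurve {γ : Set ℂ} {ℓ ℓ' : ℝ × ℝ} (h : ℓ ∈ invariantCurve γ)
    (h' : ℓ' ∈ invariantCurve γ) (he : ℓ.2 = ℓ'.2) : ℓ = ℓ' := by
  obtain ⟨⟨z, hz, hzl⟩, hl⟩ := h
  obtain ⟨⟨z', hz', hzl'⟩, hl'⟩ := h'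
  have h1 : inner ℝ (unitVec ℓ.2) z = ℓ.1 := hzl
  have h2 : inner ℝ (unitVec ℓ'.2) z' = ℓ'.1 := hzl'
  have h3 : inner ℝ (unitVec ℓ.2) z' ≤ ℓ.1 := hl hz'
  have h4 : inner ℝ (unitVec ℓ'.2) z ≤ ℓ'.1 := hl' hz
  rw [he] at h1 h3
  exact Prod.ext (by linarith) he

/-- The billiard ball map on the supporting lines of a caustic is the lift of a monotone circle
map of degree one. -/
theorem IsConvexCaustic.exists_lift {Γ : ℝ → ℂ} {γ : Set ℂ} (hΓ : IsTable Γ)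
    (hγ : IsConvexCaustic Γ γ) :
    ∃ f : CircleDeg1Lift, ∀ x : ℝ, ∃ ψ P,
      Bounce (closedRegion γ) (closedRegion (range Γ)) (2 * π * x) ψ P ∧
      BilliardLift Γ (inner ℝ (unitVec (2 * π * x)) P, 2 * π * x)
        (inner ℝ (unitVec (2 * ψ - 2 * π * x)) P, 2 * ψ - 2 * π * x) ∧
      2 * π * f x = 2 * ψ - 2 * π * x := by
  choose ψ P hb hl using hγ.exists_bounce hΓ
  have hπ : (0 : ℝ) < 2 * π := two_pi_pos
  refine ⟨⟨⟨fun x => (2 * ψ (2 * π * x) - 2 * π * x) / (2 * π), fun x y hxy => ?_⟩, fun x => ?_⟩,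
    fun x => ⟨_, _, hb _, hl _, ?_⟩⟩
  · exact div_le_div_of_nonneg_right
      ((hb _).mono (hb _) (mul_le_mul_of_nonneg_left hxy hπ.le)) hπ.le
  · have h1 := (hb (2 * π * x)).add_two_pi
    have h2 := hb (2 * π * (x + 1))
    have e : 2 * π * (x + 1) = 2 * π * x + 2 * π := by ring
    have h3 := h1.mono h2 e.ge
    have h4 := h2.mono h1 e.le
    dsimp only
    rw [div_add_one hπ.ne', div_left_inj' hπ.ne']
    linarith
  · exact mul_div_cancel₀ _ hπ.ne'

lemma HasRotationNumber.eq {Γ : ℝ → ℂ} {γ : Set ℂ} {ρ : ℝ} {f : CircleDeg1Lift} (hΓ : IsTable Γ)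
    (h : HasRotationNumber Γ γ ρ)
    (hf : ∀ x : ℝ, ∃ ψ P,
      Bounce (closedRegion γ) (closedRegion (range Γ)) (2 * π * x) ψ P ∧
      BilliardLift Γ (inner ℝ (unitVec (2 * π * x)) P, 2 * π * x)
        (inner ℝ (unitVec (2 * ψ - 2 * π * x)) P, 2 * ψ - 2 * π * x) ∧
      2 * π * f x = 2 * ψ - 2 * π * x) : ρ = f.translationNumber := by
  obtain ⟨g, rfl, hg⟩ := h
  congr 1
  refine CircleDeg1Lift.ext fun x => ?_
  obtain ⟨ψ, P, hb, hl, hx⟩ := hf x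
  obtain ⟨ℓ', -, hℓ, he⟩ := hg _ (mem_invariantCurve hb.left_in hb.touch_in)
  have hπ : (2 * π : ℝ) ≠ 0 := two_pi_pos.ne'
  have h1 := hl.angle_unique hΓ hℓ
  dsimp only at h1 he
  rw [mul_div_cancel_left₀ _ hπ, ← h1, ← hx, mul_div_cancel_left₀ _ hπ] at he
  exact he.symm

lemma IsConvexCaustic.hasRotationNumber {Γ : ℝ → ℂ} {γ : Set ℂ} {f : CircleDeg1Lift}
    (hf : ∀ x : ℝ, ∃ ψ P,
      Bounce (closedRegion γ) (closedRegion (range Γ)) (2 * π * x) ψ P ∧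
      BilliardLift Γ (inner ℝ (unitVec (2 * π * x)) P, 2 * π * x)
        (inner ℝ (unitVec (2 * ψ - 2 * π * x)) P, 2 * ψ - 2 * π * x) ∧
      2 * π * f x = 2 * ψ - 2 * π * x) : HasRotationNumber Γ γ f.translationNumber := by
  refine ⟨f, rfl, fun ℓ hℓ => ?_⟩
  have hπ : (2 * π : ℝ) ≠ 0 := two_pi_pos.ne'
  obtain ⟨ψ, P, hb, hl, hx⟩ := hf (ℓ.2 / (2 * π))
  rw [mul_div_cancel₀ _ hπ] at hb hl hx
  refine ⟨_, mem_invariantCurve hb.left_out hb.touch_out, ?_, ?_⟩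
  · rwa [eq_of_mem_invariantCurve hℓ (mem_invariantCurve hb.left_in hb.touch_in) rfl]
  · rw [← hx, mul_div_cancel_left₀ _ hπ]

/-- A caustic with interior points has rotation number less than `1 / 2`. -/
lemma translationNumber_lt_half {K L : Set ℂ} {f : CircleDeg1Lift}
    (hf : ∀ x : ℝ, ∃ ψ P, Bounce K L (2 * π * x) ψ P ∧ 2 * π * f x = 2 * ψ - 2 * π * x)
    (hK : (interior K).Nonempty) (hL : Bornology.IsBounded L) : f.translationNumber < 1 / 2 := by
  obtain ⟨c, hc⟩ := hK
  obtain ⟨r, hr, hball⟩ := Metric.nhds_basis_closedBall.mem_iff.1 (mem_interior_iff_mem_nhds.1 hc)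
  obtain ⟨D, hD⟩ := isBounded_iff_forall_norm_le.1 hL
  have hD0 : 0 < |D| + ‖c‖ + 1 := by positivity
  have hD' : ∀ z ∈ L, ‖z - c‖ ≤ |D| + ‖c‖ + 1 := fun z hz => by
    linarith [norm_sub_le z c, hD z hz, le_abs_self D]
  have hπ := pi_pos
  have hpos : 0 < r / (|D| + ‖c‖ + 1) := div_pos hr hD0
  have hlt : arccos (r / (|D| + ‖c‖ + 1)) < π / 2 := arccos_lt_pi_div_two.2 hpos
  have hle : f.translationNumber ≤ arccos (r / (|D| + ‖c‖ + 1)) / π := by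
    refine f.translationNumber_le_of_le_add fun x => ?_
    obtain ⟨ψ, P, hb, hx⟩ := hf x
    have h1 := hb.le_cos hr.le hball hD' hD0
    have h2 : ψ - 2 * π * x ≤ arccos (r / (|D| + ‖c‖ + 1)) := by
      rw [← arccos_cos (x := ψ - 2 * π * x) (by linarith [hb.lt]) (by linarith [hb.le])]
      exact arccos_le_arccos h1
    have h3 : f x = x + (ψ - 2 * π * x) / π := by
      field_simp
      linarith
    rw [h3]
    gcongr
  refine hle.trans_lt ?_
  rw [div_lt_iff₀ hπ]
  linarith

/-- A caustic contained in a line has rotation number `1 / 2`. -/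
lemma translationNumber_eq_half {A B : ℂ} {L : Set ℂ} {f : CircleDeg1Lift}
    (hf : ∀ x : ℝ, ∃ ψ P, Bounce (segment ℝ A B) L (2 * π * x) ψ P ∧
      2 * π * f x = 2 * ψ - 2 * π * x) : f.translationNumber = 1 / 2 := by
  have hπ := pi_pos
  obtain ⟨φ, hφ⟩ := exists_lineDir (B - A)
  have key : ∀ x : ℝ, sin (φ - 2 * π * x) = 0 → inner ℝ (unitVec (2 * π * x)) (B - A) = 0 := by
    intro x hx
    rw [hφ 0, inner_smul_right, inner_unitVec_lineDir, ← neg_sub φ, sin_neg, hx]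
    simp
  have hstep : ∀ x : ℝ, sin (φ - 2 * π * x) = 0 → f x = x + 1 / 2 := by
    intro x hx
    obtain ⟨ψ, P, hb, hfx⟩ := hf x
    have hψ := hb.eq_of_subset_line (by
      rw [segment_eq_image']
      rintro _ ⟨a, -, rfl⟩ _ ⟨b, -, rfl⟩
      rw [add_sub_add_left_eq_sub, ← sub_smul, inner_smul_right, key x hx, mul_zero])
    rw [hψ] at hfx
    have : 2 * π * f x = 2 * π * (x + 1 / 2) := by linarith
    exact mul_left_cancel₀ (by positivity) this
  have e : 2 * π * (φ / (2 * π)) = φ := by field_simp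
  have h1 := hstep (φ / (2 * π)) (by rw [e, sub_self, sin_zero])
  have h2 := hstep (φ / (2 * π) + 1 / 2) (by
    rw [mul_add, e, show φ - (φ + 2 * π * (1 / 2)) = -π by ring, sin_neg, sin_pi, neg_zero])
  have h3 := f.translationNumber_of_map_pow_eq_add_int (x := φ / (2 * π)) (n := 2) (m := 1) (by
    rw [pow_two, CircleDeg1Lift.mul_apply, h1, h2]
    push_cast
    ring) two_pos
  simpa using h3

/-! ### Degenerate caustics -/

/-- A compact convex set without interior points in the plane is a segment. -/
lemma exists_eq_segment {K : Set ℂ} (hK : IsCompact K) (hc : Convex ℝ K) (hne : K.Nonempty)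
    (hi : interior K = ∅) : ∃ A B, K = segment ℝ A B := by
  have hcol : Collinear ℝ K := by
    rw [collinear_iff_finrank_le_one]
    have h1 : affineSpan ℝ K ≠ ⊤ := by
      rw [Ne, ← hc.interior_nonempty_iff_affineSpan_eq_top, hi]
      exact not_nonempty_empty
    have h2 : vectorSpan ℝ K ≠ ⊤ := by
      rw [← direction_affineSpan]
      rwa [Ne, AffineSubspace.direction_eq_top_iff_of_nonempty (hne.affineSpan ℝ)]
    have h3 := Submodule.finrank_lt h2
    rw [Complex.finrank_real_complex] at h3
    omega
  obtain ⟨⟨A, B⟩, ⟨hA, hB⟩, hmax⟩ := (hK.prod hK).exists_isMaxOn (hne.prod hne)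
    (f := fun p : ℂ × ℂ => dist p.1 p.2) (by fun_prop)
  have hle : ∀ x ∈ K, ∀ y ∈ K, dist x y ≤ dist A B := fun x hx y hy => hmax (mk_mem_prod hx hy)
  refine ⟨A, B, Subset.antisymm (fun z hz => ?_) (hc.segment_subset hA hB)⟩
  rw [mem_segment_iff_wbtw]
  have h3 : Collinear ℝ {A, z, B} := hcol.subset (by
    rintro x (rfl | rfl | rfl) <;> assumption)
  rcases h3.wbtw_or_wbtw_or_wbtw with h | h | h
  · exact h
  · have h4 := dist_add_dist_eq_iff.2 h
    have h5 := hle _ hz _ hA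
    rw [dist_comm B A] at h4
    have : dist z B = 0 := le_antisymm (by linarith) dist_nonneg
    rw [dist_eq_zero.1 this]
    exact wbtw_self_right ℝ A B
  · have h4 := dist_add_dist_eq_iff.2 h
    have h5 := hle _ hB _ hz
    rw [dist_comm B A] at h4
    have : dist A z = 0 := le_antisymm (by linarith) dist_nonneg
    rw [← dist_eq_zero.1 this]
    exact wbtw_self_left ℝ A B

/-- The focal property: reflected tangent lines of a segment pass through its endpoints. -/
lemma IsConvexCaustic.focal {Γ : ℝ → ℂ} {γ : Set ℂ} (hΓ : IsTable Γ) (hγ : IsConvexCaustic Γ γ)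
    {A B : ℂ} (hK : closedRegion γ = segment ℝ A B) {t ψ : ℝ}
    (h : IsOutwardNormal (closedRegion (range Γ)) (Γ t) ψ) :
    inner ℝ (unitVec (ψ + π / 2)) (A - Γ t) = 0 ∨
      inner ℝ (unitVec ψ) (A - Γ t) * inner ℝ (unitVec (ψ + π / 2)) (B - Γ t) +
        inner ℝ (unitVec (ψ + π / 2)) (A - Γ t) * inner ℝ (unitVec ψ) (B - Γ t) = 0 := by
  have hA : A ∈ closedRegion γ := hK ▸ left_mem_segment ℝ A B
  have hB : B ∈ closedRegion γ := hK ▸ right_mem_segment ℝ A B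
  have hneg := hγ.inner_normal_neg hΓ h hA
  have hs : 0 < ‖Γ t - A‖ := by
    rw [norm_pos_iff]
    intro h0
    rw [← neg_sub, h0] at hneg
    simp at hneg
  obtain ⟨φ, hφ⟩ := exists_lineDir (Γ t - A)
  have hlin : ∀ χ : ℝ, ∀ w ∈ closedRegion γ, ∃ a ∈ Icc (0 : ℝ) 1,
      inner ℝ (unitVec χ) (w - Γ t) =
        (1 - a) * inner ℝ (unitVec χ) (A - Γ t) + a * inner ℝ (unitVec χ) (B - Γ t) := by
    intro χ w hw
    rw [hK, segment_eq_image'] at hw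
    obtain ⟨a, ha, rfl⟩ := hw
    refine ⟨a, ha, ?_⟩
    simp only [inner_sub_right, inner_add_right, inner_smul_right]
    ring
  have hA0 : inner ℝ (unitVec φ) (A - Γ t) = 0 := by
    have := smul_inner_unitVec (hφ 0) ψ (A - Γ t)
    rw [mul_comm (inner ℝ (unitVec ψ) _), sub_self] at this
    exact (mul_eq_zero.1 this).resolve_left hs.ne'
  obtain ⟨⟨w, hw, hw0⟩, hside⟩ := hγ.reflect_supporting hΓ h hA hs (hφ 0) (by
    rcases le_total (inner ℝ (unitVec φ) (B - Γ t)) 0 with h0 | h0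
    · left
      intro w hw
      obtain ⟨a, ha, e⟩ := hlin φ w hw
      rw [e, hA0, mul_zero, zero_add]
      exact mul_nonpos_of_nonneg_of_nonpos ha.1 h0
    · right
      intro w hw
      obtain ⟨a, ha, e⟩ := hlin φ w hw
      rw [e, hA0, mul_zero, zero_add]
      exact mul_nonneg ha.1 h0)
  obtain ⟨a, ha, e⟩ := hlin _ w hw
  rw [hw0] at e
  have hor : inner ℝ (unitVec (2 * ψ - φ)) (A - Γ t) = 0 ∨
      inner ℝ (unitVec (2 * ψ - φ)) (B - Γ t) = 0 := by
    have ha1 : 0 ≤ 1 - a := sub_nonneg.2 ha.2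
    have hz : (1 - a) * inner ℝ (unitVec (2 * ψ - φ)) (A - Γ t) = 0 ∧
        a * inner ℝ (unitVec (2 * ψ - φ)) (B - Γ t) = 0 := by
      rcases hside with hside | hside
      · have h1 := mul_nonpos_of_nonneg_of_nonpos ha1 (hside A hA)
        have h2 := mul_nonpos_of_nonneg_of_nonpos ha.1 (hside B hB)
        constructor <;> linarith
      · have h1 := mul_nonneg ha1 (hside A hA)
        have h2 := mul_nonneg ha.1 (hside B hB)
        constructor <;> linarith
    rcases mul_eq_zero.1 hz.1 with h1 | h1
    · rcases mul_eq_zero.1 hz.2 with h2 | h2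
      · linarith
      · exact Or.inr h2
    · exact Or.inl h1
  rcases hor with h0 | h0
  · left
    have h1 := smul_inner_unitVec_reflect (hφ 0) ψ (A - Γ t)
    rw [h0, mul_zero] at h1
    have h2 : inner ℝ (unitVec ψ) (A - Γ t) * inner ℝ (unitVec (ψ + π / 2)) (A - Γ t) = 0 := by
      linarith
    exact (mul_eq_zero.1 h2).resolve_left hneg.ne
  · right
    have h1 := smul_inner_unitVec_reflect (hφ 0) ψ (B - Γ t)
    rw [h0, mul_zero] at h1
    linarith

/-- Both focal radii make equal angles with the tangent. -/
lemma IsConvexCaustic.equal_angles {Γ : ℝ → ℂ} {γ : Set ℂ} (hΓ : IsTable Γ)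
    (hγ : IsConvexCaustic Γ γ) {A B : ℂ} (hK : closedRegion γ = segment ℝ A B) {t ψ : ℝ}
    (h : IsOutwardNormal (closedRegion (range Γ)) (Γ t) ψ) :
    inner ℝ (unitVec (ψ + π / 2)) (A - Γ t) * ‖B - Γ t‖ +
      inner ℝ (unitVec (ψ + π / 2)) (B - Γ t) * ‖A - Γ t‖ = 0 := by
  have hA := hγ.inner_normal_neg hΓ h (hK ▸ left_mem_segment ℝ A B : A ∈ closedRegion γ)
  have hB := hγ.inner_normal_neg hΓ h (hK ▸ right_mem_segment ℝ A B : B ∈ closedRegion γ)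
  have h1 := hγ.focal hΓ hK h
  have h2 := hγ.focal hΓ (hK.trans (segment_symm ℝ A B)) h
  have h3 : inner ℝ (unitVec ψ) (A - Γ t) * inner ℝ (unitVec (ψ + π / 2)) (B - Γ t) +
      inner ℝ (unitVec (ψ + π / 2)) (A - Γ t) * inner ℝ (unitVec ψ) (B - Γ t) = 0 := by
    rcases h1 with h1 | h1
    · rcases h2 with h2 | h2
      · rw [h1, h2]; ring
      · linarith
    · exact h1
  have nA := sq_add_sq_inner_unitVec ψ (A - Γ t)
  have nB := sq_add_sq_inner_unitVec ψ (B - Γ t)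
  have h4 : ‖B - Γ t‖ * inner ℝ (unitVec ψ) (A - Γ t) =
      ‖A - Γ t‖ * inner ℝ (unitVec ψ) (B - Γ t) := by
    have hsq : (‖B - Γ t‖ * -inner ℝ (unitVec ψ) (A - Γ t)) ^ 2 =
        (‖A - Γ t‖ * -inner ℝ (unitVec ψ) (B - Γ t)) ^ 2 := by
      rw [mul_pow, mul_pow, ← nA, ← nB]
      linear_combination (inner ℝ (unitVec ψ) (A - Γ t) *
        inner ℝ (unitVec (ψ + π / 2)) (B - Γ t) -
        inner ℝ (unitVec (ψ + π / 2)) (A - Γ t) * inner ℝ (unitVec ψ) (B - Γ t)) * h3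
    have h5 := (sq_eq_sq₀ (mul_nonneg (norm_nonneg _) (by linarith))
      (mul_nonneg (norm_nonneg _) (by linarith))).1 hsq
    linarith
  refine mul_left_cancel₀ hA.ne ?_
  rw [mul_zero]
  linear_combination inner ℝ (unitVec (ψ + π / 2)) (A - Γ t) * h4 + ‖A - Γ t‖ * h3

lemma hasDerivAt_dist {Γ : ℝ → ℂ} {t : ℝ} {A : ℂ} (hΓ : DifferentiableAt ℝ Γ t) (hA : A ≠ Γ t) :
    HasDerivAt (fun s => dist (Γ s) A) (-inner ℝ (A - Γ t) (deriv Γ t) / ‖A - Γ t‖) t := by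
  have hne : ‖Γ t - A‖ ≠ 0 := norm_ne_zero_iff.2 (sub_ne_zero.2 hA.symm)
  have h1 := ((hΓ.hasDerivAt.sub_const A).norm_sq).sqrt (pow_ne_zero 2 hne)
  simp only [sqrt_sq (norm_nonneg _)] at h1
  simp only [dist_eq_norm]
  convert h1 using 1
  rw [norm_sub_rev A, ← neg_sub (Γ t) A, inner_neg_left, neg_neg]
  field_simp

lemma IsConvexCaustic.dist_add_dist_eq {Γ : ℝ → ℂ} {γ : Set ℂ} (hΓ : IsTable Γ)
    (hγ : IsConvexCaustic Γ γ) {A B : ℂ} (hK : closedRegion γ = segment ℝ A B) (t u : ℝ) :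
    dist (Γ t) A + dist (Γ t) B = dist (Γ u) A + dist (Γ u) B := by
  have hd : ∀ t, HasDerivAt (fun s => dist (Γ s) A + dist (Γ s) B) 0 t := by
    intro t
    obtain ⟨ψ, h⟩ := hΓ.exists_normal hγ.enclosed_nonempty t
    have hA := hγ.inner_normal_neg hΓ h (hK ▸ left_mem_segment ℝ A B : A ∈ closedRegion γ)
    have hB := hγ.inner_normal_neg hΓ h (hK ▸ right_mem_segment ℝ A B : B ∈ closedRegion γ)
    have hA' : A ≠ Γ t := by rintro rfl; simp at hA
    have hB' : B ≠ Γ t := by rintro rfl; simp at hB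
    have hnA : ‖A - Γ t‖ ≠ 0 := norm_ne_zero_iff.2 (sub_ne_zero.2 hA')
    have hnB : ‖B - Γ t‖ ≠ 0 := norm_ne_zero_iff.2 (sub_ne_zero.2 hB')
    have h1 := (hasDerivAt_dist (hΓ.differentiable t) hA').add
      (hasDerivAt_dist (hΓ.differentiable t) hB')
    have h2 := hγ.equal_angles hΓ hK h
    have h3 := hΓ.inner_normal_deriv h
    refine h1.congr_deriv ?_
    rw [div_add_div _ _ hnA hnB, div_eq_zero_iff]
    left
    have key : ∀ w : ℂ, inner ℝ w (deriv Γ t) =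
        inner ℝ (unitVec (ψ + π / 2)) (deriv Γ t) * inner ℝ (unitVec (ψ + π / 2)) w := by
      intro w
      rw [inner_unitVec] at h3
      rw [inner_eq, inner_unitVec_add_pi_div_two, inner_unitVec_add_pi_div_two]
      linear_combination (w.re * cos ψ + w.im * sin ψ) * h3 -
        (w.re * (deriv Γ t).re + w.im * (deriv Γ t).im) * sin_sq_add_cos_sq ψ
    rw [key (A - Γ t), key (B - Γ t)]
    linear_combination (-inner ℝ (unitVec (ψ + π / 2)) (deriv Γ t)) * h2
  exact is_const_of_deriv_eq_zero (fun t => (hd t).differentiableAt) (fun t => (hd t).deriv) t u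

/-- A table on which the sum of the distances to the points `A` and `B` is constant is the full
level set of that sum. -/
lemma IsTable.range_eq_of_dist_add_dist {Γ : ℝ → ℂ} (hΓ : IsTable Γ) {A B : ℂ} {S : ℝ}
    (hA : A ∈ enclosed (range Γ)) (hS : dist A B < S)
    (h : ∀ t, dist (Γ t) A + dist (Γ t) B = S) :
    range Γ = {P : ℂ | dist P A + dist P B = S} := by
  refine Subset.antisymm ?_ fun Q hQ => ?_
  · rintro _ ⟨t, rfl⟩
    exact h t
  · have hF : ConvexOn ℝ univ fun P => dist P A + dist P B :=
      (convexOn_univ_dist A).add (convexOn_univ_dist B)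
    have hQ' : dist Q A + dist Q B = S := hQ
    have hQA : Q - A ≠ 0 := by
      rw [sub_ne_zero]
      rintro rfl
      simp at hQ'
      exact hS.ne hQ'
    obtain ⟨s, hs, hsf⟩ := exists_mem_frontier_ray hΓ.convex.isCompact_closedRegion
      (hΓ.convex.interior_closedRegion.symm ▸ hA) hQA
    rw [hΓ.convex.frontier_eq] at hsf
    obtain ⟨t, ht⟩ := hsf
    have key : ∀ {r : ℝ} {X : ℂ}, 0 ≤ r → r < 1 → dist X A + dist X B = S →
        dist (A + r • (X - A)) A + dist (A + r • (X - A)) B < S := by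
      intro r X h0 h1 hX
      have := hF.2 (mem_univ A) (mem_univ X) (sub_nonneg.2 h1.le) h0 (sub_add_cancel 1 r)
      rw [show (1 - r) • A + r • X = A + r • (X - A) by module] at this
      simp only [smul_eq_mul, dist_self, zero_add, hX] at this
      nlinarith
    rcases lt_trichotomy s 1 with h1 | rfl | h1
    · have h2 := key hs.le h1 hQ'
      rw [← ht, h t] at h2
      exact absurd h2 (lt_irrefl _)
    · exact ⟨t, by rw [ht]; simp⟩
    · have h2 := key (r := s⁻¹) (inv_nonneg.2 hs.le) (inv_lt_one_of_one_lt₀ h1) (h t)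
      rw [ht, add_sub_cancel_left, smul_smul, inv_mul_cancel₀ hs.ne', one_smul,
        add_sub_cancel] at h2
      exact absurd h2 (by rw [hQ']; exact lt_irrefl _)

end Billiard

theorem mainTheorem4 (Γ : ℝ → ℂ) (hΓ : Billiard.IsTable Γ)
    (γ : Set ℂ) (hγ : Billiard.IsConvexCaustic Γ γ) :
    (∃! ρ : ℝ, Billiard.HasRotationNumber Γ γ ρ) ∧
    (∀ ρ : ℝ, Billiard.HasRotationNumber Γ γ ρ →
      ((Billiard.enclosed γ).Nonempty ↔ ρ < 1 / 2)) ∧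
    (Billiard.enclosed γ = ∅ →
      (∃ (c : ℂ) (r : ℝ), 0 < r ∧ γ = {c} ∧ range Γ = Metric.sphere c r) ∨
      (∃ (A B : ℂ) (S : ℝ), A ≠ B ∧ dist A B < S ∧ γ = segment ℝ A B ∧
        range Γ = {P : ℂ | dist P A + dist P B = S})) := by
  obtain ⟨f, hf⟩ := hγ.exists_lift hΓ
  have hf' : ∀ x : ℝ, ∃ ψ P, Billiard.Bounce (Billiard.closedRegion γ)
      (Billiard.closedRegion (range Γ)) (2 * π * x) ψ P ∧ 2 * π * f x = 2 * ψ - 2 * π * x :=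
    fun x => (hf x).imp fun ψ => Exists.imp fun P h => ⟨h.1, h.2.2⟩
  have hint := hγ.isConvexCurve.interior_closedRegion
  have hseg : Billiard.enclosed γ = ∅ → ∃ A B, Billiard.closedRegion γ = segment ℝ A B :=
    fun h => Billiard.exists_eq_segment hγ.isConvexCurve.isCompact_closedRegion
      hγ.isConvexCurve.convex hγ.closedRegion_nonempty (hint.trans h)
  refine ⟨⟨_, Billiard.IsConvexCaustic.hasRotationNumber hf, fun ρ hρ => hρ.eq hΓ hf⟩,
    fun ρ hρ => ?_, fun hempty => ?_⟩
  · rw [hρ.eq hΓ hf]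
    constructor
    · intro h
      exact Billiard.translationNumber_lt_half hf' (hint.symm ▸ h)
        hΓ.convex.isCompact_closedRegion.isBounded
    · intro h
      by_contra hne
      obtain ⟨A, B, hAB⟩ := hseg (not_nonempty_iff_eq_empty.1 hne)
      rw [hAB] at hf'
      exact h.ne (Billiard.translationNumber_eq_half hf')
  · obtain ⟨A, B, hAB⟩ := hseg hempty
    have hγK : γ = segment ℝ A B := by
      rw [← hAB, Billiard.closedRegion, hempty, empty_union]
    have hA : A ∈ Billiard.enclosed (range Γ) :=
      hγ.subset (hγK ▸ left_mem_segment ℝ A B)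
    have hS : dist A B < dist (Γ 0) A + dist (Γ 0) B := by
      rw [dist_comm (Γ 0) A]
      refine lt_of_le_of_ne (dist_triangle _ _ _) fun heq => ?_
      have hw := dist_add_dist_eq_iff.1 heq.symm
      rw [← mem_segment_iff_wbtw, ← hγK] at hw
      exact (hγ.subset hw).1 (mem_range_self 0)
    have hrange := hΓ.range_eq_of_dist_add_dist hA hS
      fun t => hγ.dist_add_dist_eq hΓ hAB t 0
    by_cases hne : A = B
    · left
      subst hne
      refine ⟨A, dist (Γ 0) A, ?_, by rw [hγK, segment_same], hrange.trans ?_⟩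
      · rw [dist_self] at hS
        linarith
      · ext P
        simp only [mem_ofPred_eq, Metric.mem_sphere]
        constructor <;> intro h <;> linarith
    · exact Or.inr ⟨A, B, _, hne, hS, hγK, hrange⟩
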